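/- A matroid $M$ on the ground set $E=\{1,\dots,n\}$ is connected if it is not a direct sum of two matroids with nonempty ground sets, and sparse paving if both $M$ and its dual $M^*$ have the property that every circuit has at least as many elements as the rank of the matroid. The basis polytope of $M$ is $$\mathscr{P}(M)=\operatorname{conv}\Big\{\sum_{i\in B}e_i : B \text{ a basis of } M\Big\}\subseteq\mathbb{R}^n,$$ and its Ehrhart polynomial is the polynomial $p$ with $p(t)=\#\big(t\mathscr{P}(M)\cap\mathbb{Z}^n\big)$ for all integers $t\ge 0$. Theorem. For every $n\ge 19$ there exists a connected sparse paving matroid on $n$ elements whose basis polytope has an Ehrhart polynomial with at least one negative coefficient. In particular, for every $n\geq 19$ there is a connected matroid on $n$ elements that is not Ehrhart positive. -/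

import Mathlib

open scoped Pointwise
open Polynomial

namespace Matroid

variable {α : Type*}

/-- A matroid is connected if it is not a direct sum of two matroids with nonempty ground sets. -/
def IsConnected (M : Matroid α) : Prop :=
  ¬ ∃ (M₁ M₂ : Matroid α) (h : Disjoint M₁.E M₂.E),
    M₁.E.Nonempty ∧ M₂.E.Nonempty ∧ M = M₁.disjointSum M₂ h

/-- A matroid is paving if every circuit has at least as many elements as the rank. -/
def IsPaving (M : Matroid α) : Prop :=
  ∀ C, M.IsCircuit C → M.eRank ≤ C.encard

/-- A matroid is sparse paving if it and its dual are both paving. -/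
def IsSparsePaving (M : Matroid α) : Prop :=
  M.IsPaving ∧ M✶.IsPaving

/-- The basis polytope: the convex hull in `ℝⁿ` of the indicator vectors of the bases. -/
noncomputable def basisPolytope {n : ℕ} (M : Matroid (Fin n)) : Set (Fin n → ℝ) :=
  convexHull ℝ {v | ∃ B, M.IsBase B ∧ v = Set.indicator B 1}

end Matroid

/-- The number of points of `ℤⁿ` in the dilation `t • P`. -/
noncomputable def latticePointCount {n : ℕ} (P : Set (Fin n → ℝ)) (t : ℕ) : ℕ :=
  {z : Fin n → ℤ | (fun i => (z i : ℝ)) ∈ (t : ℝ) • P}.ncard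

/-- `p` is the Ehrhart polynomial of `P`: its value at every natural number `t` is the number of
lattice points of `t • P`. There is at most one such polynomial. -/
def IsEhrhartPolynomial {n : ℕ} (P : Set (Fin n → ℝ)) (p : ℚ[X]) : Prop :=
  ∀ t : ℕ, p.eval (t : ℚ) = (latticePointCount P t : ℚ)

/-! Deleting a stable family `F` from the `k`-sets of an `n`-set leaves the bases of a sparse paving
matroid. Its polytope is the hypersimplex with one corner cut off for each `H ∈ F`, by the
inequality that the coordinates in `H` sum to at most `k - 1`. An integer decomposition argument
(`exists_decomposition`) shows that these inequalities describe the lattice points of every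
dilation. Stability makes the cut-off pieces disjoint, and all have the same number of points, so
the Ehrhart polynomial is the hypersimplex polynomial minus `#F` times a fixed polynomial
(`latticePointCount_add`).

The quadratic coefficients of both polynomials have closed forms in harmonic numbers and binomials,
so a large enough `F` makes the quadratic coefficient negative. Rank `9` is used throughout, with `n
= b + 10`. For `n ≥ 20`, sorting the `9`-sets by their sum modulo `n` gives a stable family of at
least `n.choose 9 / n` sets, which suffices. For `n = 19` that average is only 4862, and an explicit
code of 6327 sets, invariant under a group of affine maps of `ZMod 19`, is used instead. -/

open Finset in
/-- A stable set of the Johnson graph: a family of `k`-sets, any two of which have at most `k - 2`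
common elements. -/
structure IsStableFamily {α : Type*} [DecidableEq α] (k : ℕ) (F : Finset (Finset α)) : Prop where
  card_eq : ∀ ⦃A⦄, A ∈ F → #A = k
  card_inter : ∀ ⦃A⦄, A ∈ F → ∀ ⦃B⦄, B ∈ F → A ≠ B → #(A ∩ B) + 2 ≤ k

/-! ### Stable families and basis exchange -/

section StableFamily

open Finset

variable {α : Type*} [DecidableEq α] {k : ℕ} {F : Finset (Finset α)}

lemma card_insert_erase {A : Finset α} {a b : α} (ha : a ∈ A) (hb : b ∉ A) :
    #(insert b (A.erase a)) = #A := by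
  rw [card_insert_of_notMem (fun h => hb (mem_of_mem_erase h)), card_erase_add_one ha]

namespace IsStableFamily

lemma notMem_of_card_inter (hF : IsStableFamily k F) {A B : Finset α} (hA : A ∈ F) (hne : A ≠ B)
    (h : k ≤ #(A ∩ B) + 1) : B ∉ F := fun hB => by
  have := hF.card_inter hA hB hne
  omega

lemma exchange_notMem (hF : IsStableFamily k F) {A : Finset α} {a b : α} (hA : A ∈ F)
    (ha : a ∈ A) (hb : b ∉ A) : insert b (A.erase a) ∉ F := by
  refine hF.notMem_of_card_inter hA (fun h => hb (h ▸ mem_insert_self _ _)) ?_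
  have h1 : A.erase a ⊆ A ∩ insert b (A.erase a) :=
    subset_inter (erase_subset _ _) (subset_insert _ _)
  have h2 := card_le_card h1
  rw [card_erase_of_mem ha, hF.card_eq hA] at h2
  omega

/-- The two exchanged sets share the `k - 1` elements of `A.erase a`, so they are adjacent in the
Johnson graph. With `exchange_left`, this says that a blocked exchange can be repaired by changing
either element. -/
lemma exchange_right (hF : IsStableFamily k F) {A : Finset α} {a b b' : α} (ha : a ∈ A)
    (hb : b ∉ A) (hbb : b ≠ b') (h : insert b (A.erase a) ∈ F) :
    insert b' (A.erase a) ∉ F := by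
  have hA : #A = k := card_insert_erase ha hb ▸ hF.card_eq h
  refine hF.notMem_of_card_inter h (fun h' => ?_) ?_
  · have : b ∈ insert b' (A.erase a) := h' ▸ mem_insert_self _ _
    rcases mem_insert.1 this with h1 | h1
    exacts [hbb h1, hb (mem_of_mem_erase h1)]
  · have h2 := card_le_card (subset_inter (subset_insert b (A.erase a)) (subset_insert b' _))
    rw [card_erase_of_mem ha, hA] at h2
    omega

lemma exchange_left (hF : IsStableFamily k F) {A : Finset α} {a a' b : α} (ha : a ∈ A)
    (ha' : a' ∈ A) (hb : b ∉ A) (haa : a ≠ a') (h : insert b (A.erase a) ∈ F) :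
    insert b (A.erase a') ∉ F := by
  have hA : #A = k := card_insert_erase ha hb ▸ hF.card_eq h
  refine hF.notMem_of_card_inter h (fun h' => ?_) ?_
  · have : a ∈ insert b (A.erase a) := h' ▸ mem_insert_of_mem (mem_erase.2 ⟨haa, ha⟩)
    rcases mem_insert.1 this with h1 | h1
    exacts [hb (h1 ▸ ha), notMem_erase _ _ h1]
  · have h1 : insert b ((A.erase a).erase a') ⊆
        insert b (A.erase a) ∩ insert b (A.erase a') := by
      intro x hx
      simp only [mem_insert, mem_erase, mem_inter] at hx ⊢
      tauto
    have h2 := card_le_card h1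
    rw [card_insert_of_notMem (by simp [hb]), card_erase_of_mem (mem_erase.2 ⟨haa.symm, ha'⟩),
      card_erase_of_mem ha, hA] at h2
    omega

lemma exists_superset_notMem [Fintype α] (hF : IsStableFamily k F) (hkn : k < Fintype.card α)
    {I : Finset α} (hI : #I < k) : ∃ B, I ⊆ B ∧ #B = k ∧ B ∉ F := by
  obtain ⟨A, hIA, hA⟩ := exists_superset_card_eq (s := I) (n := k) hI.le hkn.le
  by_cases hAF : A ∈ F
  · obtain ⟨a, haA, haI⟩ := exists_of_ssubset (hIA.ssubset_of_ne (by rintro rfl; omega))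
    obtain ⟨b, hb⟩ : ∃ b, b ∉ A := by
      by_contra! h
      rw [eq_univ_of_forall h, card_univ] at hA
      omega
    refine ⟨insert b (A.erase a), fun x hx => ?_, by rw [card_insert_erase haA hb, hA],
      hF.exchange_notMem hAF haA hb⟩
    exact mem_insert_of_mem (mem_erase.2 ⟨fun h => haI (h ▸ hx), hIA hx⟩)
  · exact ⟨A, hIA, hA, hAF⟩

lemma exists_subset_notMem [Fintype α] (hF : IsStableFamily k F) (hk : 0 < k)
    {J : Finset α} (hJ : k < #J) : ∃ B, B ⊆ J ∧ #B = k ∧ B ∉ F := by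
  obtain ⟨A, hAJ, hA⟩ := exists_subset_card_eq hJ.le
  by_cases hAF : A ∈ F
  · obtain ⟨b, hbJ, hbA⟩ := exists_of_ssubset (hAJ.ssubset_of_ne (by rintro rfl; omega))
    obtain ⟨a, ha⟩ := card_pos.1 (hA ▸ hk)
    refine ⟨insert b (A.erase a), ?_, by rw [card_insert_erase ha hbA, hA],
      hF.exchange_notMem hAF ha hbA⟩
    exact insert_subset hbJ ((erase_subset _ _).trans hAJ)
  · exact ⟨A, hAJ, hA, hAF⟩

/-- If exchanging `a` for `b` is blocked, any other `b' ∈ B \ A` works. If there is no other, the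
exchanged set is `B` itself, which is not in `F`. -/
lemma exchangeProperty (hF : IsStableFamily k F) :
    Matroid.ExchangeProperty fun B : Set α => ∃ S : Finset α, (S : Set α) = B ∧ #S = k ∧ S ∉ F := by
  rintro _ _ ⟨A, rfl, hA, hAF⟩ ⟨B, rfl, hB, hBF⟩ a ha
  have haA : a ∈ A := by simpa using ha.1
  have haB : a ∉ B := by simpa using ha.2
  have hcard : #(B \ A) = #(A \ B) := card_sdiff_comm (hB.trans hA.symm)
  have hpos : 0 < #(A \ B) := card_pos.2 ⟨a, mem_sdiff.2 ⟨haA, haB⟩⟩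
  suffices ∃ b, b ∈ B ∧ b ∉ A ∧ insert b (A.erase a) ∉ F by
    obtain ⟨b, hbB, hbA, hb⟩ := this
    refine ⟨b, ⟨by simpa using hbB, by simpa using hbA⟩, insert b (A.erase a), by simp,
      by rw [card_insert_erase haA hbA, hA], hb⟩
  obtain ⟨b, hb⟩ := card_pos.1 (hcard ▸ hpos)
  have hb' := mem_sdiff.1 hb
  by_cases hbF : insert b (A.erase a) ∈ F
  · by_cases h1 : ∃ b' ∈ B \ A, b ≠ b'
    · obtain ⟨b', hb1, hne⟩ := h1
      rw [mem_sdiff] at hb1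
      exact ⟨b', hb1.1, hb1.2, hF.exchange_right haA hb'.2 hne hbF⟩
    · push Not at h1
      have hBA : B \ A = {b} := by
        ext x
        exact ⟨fun hx => by simp [h1 x hx], fun hx => by rw [mem_singleton.1 hx]; exact hb⟩
      have hAB : A \ B = {a} := by
        rw [hBA, card_singleton] at hcard
        obtain ⟨c, hc⟩ := card_eq_one.1 hcard.symm
        have : a ∈ A \ B := mem_sdiff.2 ⟨haA, haB⟩
        rw [hc, mem_singleton] at this
        rw [hc, this]
      have : insert b (A.erase a) = B := by
        ext x
        have e1 := congrArg (x ∈ ·) hBA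
        have e2 := congrArg (x ∈ ·) hAB
        simp only [mem_sdiff, mem_singleton, eq_iff_iff] at e1 e2
        simp only [mem_insert, mem_erase]
        tauto
      exact absurd (this ▸ hbF) hBF
  · exact ⟨b, hb'.1, hb'.2, hbF⟩

end IsStableFamily

end StableFamily

/-! ### The matroid of a stable family -/

section SparsePaving

open Finset

variable {α : Type*} [DecidableEq α] [Fintype α] {k : ℕ} {F : Finset (Finset α)}

/-- The matroid whose bases are the `k`-sets outside a stable family. -/
def IsStableFamily.matroid (hF : IsStableFamily k F) (hk : 0 < k) (hkn : k < Fintype.card α) :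
    Matroid α :=
  Matroid.ofIsBaseOfFinite (E := Set.univ) Set.finite_univ
    (fun B => ∃ S : Finset α, (S : Set α) = B ∧ #S = k ∧ S ∉ F)
    (by
      obtain ⟨B, -, h, h'⟩ := hF.exists_superset_notMem hkn (I := ∅) (by simpa using hk)
      exact ⟨B, B, rfl, h, h'⟩)
    hF.exchangeProperty (fun _ _ => Set.subset_univ _)

namespace IsStableFamily

variable (hF : IsStableFamily k F) (hk : 0 < k) (hkn : k < Fintype.card α)

lemma matroid_E : (hF.matroid hk hkn).E = Set.univ := rfl

lemma matroid_isBase {B : Set α} :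
    (hF.matroid hk hkn).IsBase B ↔ ∃ S : Finset α, (S : Set α) = B ∧ #S = k ∧ S ∉ F := by
  simp [matroid]

lemma matroid_isBase_coe {S : Finset α} :
    (hF.matroid hk hkn).IsBase (S : Set α) ↔ #S = k ∧ S ∉ F := by
  rw [matroid_isBase]
  constructor
  · rintro ⟨T, hT, h⟩
    rwa [← coe_injective hT]
  · exact fun h => ⟨S, rfl, h⟩

/-- Every set of fewer than `k` elements extends to a basis and every set of more than `k` elements
contains one, so neither the matroid nor its dual has a circuit smaller than its rank. -/
lemma matroid_isSparsePaving : (hF.matroid hk hkn).IsSparsePaving := by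
  constructor
  · intro C hC
    obtain ⟨B, hB⟩ := (hF.matroid hk hkn).exists_isBase
    obtain ⟨S, rfl, hS, hSF⟩ := (hF.matroid_isBase hk hkn).1 hB
    rw [← hB.encard_eq_eRank, Set.encard_coe_eq_coe_finsetCard, hS]
    by_contra! hlt
    obtain ⟨C, rfl⟩ := (Set.toFinite C).exists_finset_coe
    rw [Set.encard_coe_eq_coe_finsetCard, Nat.cast_lt] at hlt
    obtain ⟨B', hCB, hB', hBF⟩ := hF.exists_superset_notMem hkn hlt
    exact hC.not_indep (((hF.matroid_isBase_coe hk hkn).2 ⟨hB', hBF⟩).indep.subset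
      (by exact_mod_cast hCB))
  · intro C hC
    obtain ⟨B, hB⟩ := (hF.matroid hk hkn).exists_isBase
    have hBd := hB.compl_isBase_dual
    obtain ⟨S, rfl, hS, hSF⟩ := (hF.matroid_isBase hk hkn).1 hB
    rw [← hBd.encard_eq_eRank, matroid_E, ← Set.compl_eq_univ_sdiff, ← coe_compl,
      Set.encard_coe_eq_coe_finsetCard, card_compl, hS]
    by_contra! hlt
    obtain ⟨C, rfl⟩ := (Set.toFinite C).exists_finset_coe
    rw [Set.encard_coe_eq_coe_finsetCard, Nat.cast_lt] at hlt
    obtain ⟨B', hCB, hB', hBF⟩ := hF.exists_subset_notMem hk (J := Cᶜ)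
      (by rw [card_compl]; omega)
    refine hC.not_indep ?_
    rw [Matroid.dual_indep_iff_exists (Set.subset_univ _)]
    refine ⟨B', (hF.matroid_isBase_coe hk hkn).2 ⟨hB', hBF⟩, ?_⟩
    rw [disjoint_coe]
    exact disjoint_left.2 fun x hx hx' => (mem_compl.1 (hCB hx')) hx

/-- In a direct sum, an exchange across the summands changes the size of the part in each summand,
so it must land in `F`; stability allows very few such exchanges. Five elements are needed: for `n =
4`, `k = 2`, removing two complementary pairs leaves a direct sum. -/
lemma matroid_isConnected (hk2 : 2 ≤ k) (hkn2 : k + 2 ≤ Fintype.card α) (h5 : 5 ≤ Fintype.card α) :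
    (hF.matroid hk hkn).IsConnected := by
  rintro ⟨M₁, M₂, hd, ⟨e₁, he₁⟩, ⟨e₂, he₂⟩, hM⟩
  have hE : M₁.E ∪ M₂.E = Set.univ := by
    rw [← Matroid.disjointSum_ground_eq (h := hd), ← hM, matroid_E]
  obtain ⟨B₀, hB₀⟩ := (hF.matroid hk hkn).exists_isBase
  obtain ⟨B, rfl, hB, hBF⟩ := (hF.matroid_isBase hk hkn).1 hB₀
  -- an exchange across the two summands never yields a basis
  have key : ∀ (N₁ N₂ : Matroid α) (h : Disjoint N₁.E N₂.E),
      hF.matroid hk hkn = N₁.disjointSum N₂ h → ∀ x ∈ B, x ∈ N₁.E → ∀ y ∉ B, y ∈ N₂.E →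
      insert y (B.erase x) ∈ F := by
    intro N₁ N₂ h hN x hx hx1 y hy hy2
    by_contra hcon
    have hB' := (hF.matroid_isBase_coe hk hkn).2 ⟨(card_insert_erase hx hy).trans hB, hcon⟩
    rw [hN, Matroid.disjointSum_isBase_iff] at hB'
    rw [hN, Matroid.disjointSum_isBase_iff] at hB₀
    have hsub : ((insert y (B.erase x) : Finset α) : Set α) ∩ N₁.E ⊆ (B : Set α) ∩ N₁.E := by
      rintro z ⟨hz, hz1⟩
      refine ⟨?_, hz1⟩
      simp only [coe_insert, coe_erase, Set.mem_insert_iff, Set.mem_sdiff] at hz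
      rcases hz with rfl | hz
      · exact absurd hy2 (Set.disjoint_left.1 h hz1)
      · exact hz.1
    have heq := hB'.1.eq_of_subset_isBase hB₀.1 hsub
    have : x ∈ ((insert y (B.erase x) : Finset α) : Set α) ∩ N₁.E := heq ▸ ⟨hx, hx1⟩
    have hxy : x ≠ y := fun h => hy (h ▸ hx)
    simp [hxy] at this
  have key₁ := key M₁ M₂ hd hM
  have key₂ := key M₂ M₁ hd.symm (hM.trans Matroid.disjointSum_comm)
  have hor : ∀ x, x ∈ M₁.E ∨ x ∈ M₂.E := fun x => by
    have := Set.mem_univ x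
    rwa [← hE] at this
  have hB1 : 1 < #B := by omega
  have hBc : 1 < #Bᶜ := by rw [card_compl]; omega
  have cross : ∀ (X Y : Set α), (∀ z, z ∈ X ∨ z ∈ Y) →
      (∀ x ∈ B, x ∈ X → ∀ y ∉ B, y ∈ Y → insert y (B.erase x) ∈ F) →
      (∀ x ∈ B, x ∈ Y → ∀ y ∉ B, y ∈ X → insert y (B.erase x) ∈ F) →
      ∀ x ∈ B, x ∈ X → ∀ y ∉ B, y ∈ Y →
        (∀ x' ∈ B, x' ≠ x → x' ∉ X) ∧ (∀ y' ∉ B, y' ≠ y → y' ∉ Y) := by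
    intro X Y hXY h1 h2 x hx hxX y hy hyY
    refine ⟨fun x' hx' hne hxX' => ?_, fun y' hy' hne hyY' => ?_⟩
    · exact hF.exchange_left hx hx' hy hne.symm (h1 x hx hxX y hy hyY) (h1 x' hx' hxX' y hy hyY)
    · exact hF.exchange_right hx hy hne.symm (h1 x hx hxX y hy hyY) (h1 x hx hxX y' hy' hyY')
  have c₁ := cross _ _ hor key₁ key₂
  have c₂ := cross _ _ (fun z => (hor z).symm) key₂ key₁
  by_cases hP : ∃ x ∈ B, x ∈ M₁.E ∧ ∃ y ∉ B, y ∈ M₂.E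
  · obtain ⟨x, hx, hx1, y, hy, hy2⟩ := hP
    obtain ⟨hX, hY⟩ := c₁ x hx hx1 y hy hy2
    obtain ⟨x', hx', hxx⟩ := exists_mem_ne hB1 x
    obtain ⟨y', hy', hyy⟩ := exists_mem_ne hBc y
    rw [mem_compl] at hy'
    have hx2 := (hor x').resolve_left (hX x' hx' hxx)
    have hy1 := (hor y').resolve_right (hY y' hy' hyy)
    obtain ⟨hX', hY'⟩ := c₂ x' hx' hx2 y' hy' hy1
    -- Both crossing directions now occur, each with a unique pair, so the ground set has at most
    -- four elements.
    have h1 : B ⊆ {x, x'} := fun z hz => by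
      simp only [mem_insert, mem_singleton]
      by_contra! h
      exact (hor z).elim (hX z hz h.1) (hX' z hz h.2)
    have h2 : Bᶜ ⊆ {y, y'} := fun z hz => by
      simp only [mem_insert, mem_singleton]
      rw [mem_compl] at hz
      by_contra! h
      exact (hor z).elim (hY' z hz h.2) (hY z hz h.1)
    have h3 := (card_le_card h1).trans card_le_two
    have h4 := (card_le_card h2).trans card_le_two
    rw [card_compl] at h4
    omega
  · by_cases hQ : ∃ x ∈ B, x ∈ M₂.E ∧ ∃ y ∉ B, y ∈ M₁.E
    · obtain ⟨x, hx, hx1, y, hy, hy2⟩ := hQ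
      obtain ⟨hX, hY⟩ := c₂ x hx hx1 y hy hy2
      obtain ⟨x', hx', hxx⟩ := exists_mem_ne hB1 x
      obtain ⟨y', hy', hyy⟩ := exists_mem_ne hBc y
      rw [mem_compl] at hy'
      exact hP ⟨x', hx', (hor x').resolve_right (hX x' hx' hxx), y', hy',
        (hor y').resolve_left (hY y' hy' hyy)⟩
    -- With no crossing pair, the basis and its complement, both nonempty, lie in the same summand,
    -- so the other summand is empty.
    · obtain ⟨b, hb⟩ := card_pos.1 (zero_lt_one.trans hB1)
      obtain ⟨c, hc⟩ := card_pos.1 (zero_lt_one.trans hBc)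
      rw [mem_compl] at hc
      push Not at hP hQ
      have := hor b
      have := hor c
      by_cases h1 : e₁ ∈ B <;> by_cases h2 : e₂ ∈ B <;> grind

end IsStableFamily
end SparsePaving

/-! ### Integer decomposition -/

section Decomposition

open Finset

variable {α : Type*} [DecidableEq α] {k : ℕ}

/-- Peel off one `k`-set that contains every coordinate equal to the maximum `t + 1` and avoids
every zero coordinate. The total `k * (t + 1)` forces at most `k` maximal and at least `k` nonzero
coordinates, so such a set exists. -/
lemma exists_card_eq_decomposition [Fintype α] {t : ℕ} {z : α → ℕ} (hz : ∀ x, z x ≤ t)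
    (hsum : ∑ x, z x = k * t) :
    ∃ f : Fin t → Finset α, (∀ i, #(f i) = k) ∧ ∀ x, z x = ∑ i, if x ∈ f i then 1 else 0 := by
  induction t generalizing z with
  | zero => exact ⟨fun i => i.elim0, fun i => i.elim0, fun x => by simpa using hz x⟩
  | succ t ih =>
    have hsub : ({x | z x = t + 1} : Finset α) ⊆ ({x | 1 ≤ z x} : Finset α) := by
      intro x
      simp only [mem_filter, mem_univ, true_and]
      omega
    have h1 : #({x | z x = t + 1} : Finset α) ≤ k := by
      have : #({x | z x = t + 1} : Finset α) * (t + 1) ≤ k * (t + 1) := by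
        rw [← hsum, ← smul_eq_mul]
        refine (card_nsmul_le_sum _ z _ fun x hx => ?_).trans
          (sum_le_sum_of_subset (subset_univ _))
        exact (mem_filter.1 hx).2.ge
      exact Nat.le_of_mul_le_mul_right this t.succ_pos
    have h2 : k ≤ #({x | 1 ≤ z x} : Finset α) := by
      have : k * (t + 1) ≤ #({x | 1 ≤ z x} : Finset α) * (t + 1) := by
        rw [← hsum, ← smul_eq_mul, ← sum_filter_add_sum_filter_not univ (fun x => 1 ≤ z x),
          sum_eq_zero (s := filter (fun x => ¬ 1 ≤ z x) univ), add_zero]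
        · exact sum_le_card_nsmul _ _ _ fun x _ => hz x
        · intro x hx
          have := (mem_filter.1 hx).2
          omega
      exact Nat.le_of_mul_le_mul_right this t.succ_pos
    obtain ⟨B, hB1, hB2, hB⟩ := exists_subsuperset_card_eq hsub h1 h2
    have hBz : ∀ x ∈ B, 1 ≤ z x := fun x hx => (mem_filter.1 (hB2 hx)).2
    have hzB : ∀ x, x ∉ B → z x ≤ t := fun x hx => by
      have := hz x
      have h : z x ≠ t + 1 := fun h => hx (hB1 (mem_filter.2 ⟨mem_univ _, h⟩))
      omega
    have hadd : ∀ x, z x = (if x ∈ B then 1 else 0) + (z x - if x ∈ B then 1 else 0) := by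
      intro x
      split_ifs with hx
      · have := hBz x hx
        omega
      · omega
    obtain ⟨f, hf, hfz⟩ := ih (z := fun x => z x - if x ∈ B then 1 else 0) (fun x => by
        have := hz x
        have := hzB x
        split_ifs with hx
        · omega
        · exact this hx) (by
        have := sum_congr rfl fun x (_ : x ∈ univ) => hadd x
        rw [sum_add_distrib, hsum, sum_boole, filter_mem_eq_inter, univ_inter, hB, Nat.cast_id,
          mul_add, mul_one] at this
        omega)
    refine ⟨Fin.cons B f, fun i => ?_, fun x => ?_⟩
    · refine Fin.cases ?_ (fun i => ?_) i
      · simpa using hB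
      · simpa using hf i
    · rw [Fin.sum_univ_succ]
      simp only [Fin.cons_zero, Fin.cons_succ]
      rw [← hfz x]
      exact hadd x

lemma sum_update_update {ι β : Type*} [Fintype ι] [DecidableEq ι] (f : ι → β) (g : β → ℕ) {i j : ι}
    (hij : i ≠ j) (a b : β) :
    ∑ l, g (Function.update (Function.update f i a) j b l) + g (f i) + g (f j) =
      ∑ l, g (f l) + g a + g b := by
  have key : ∀ (f : ι → β) (i : ι) (a : β),
      ∑ l, g (Function.update f i a l) + g (f i) = ∑ l, g (f l) + g a := by
    intro f i a
    rw [← add_sum_erase _ _ (mem_univ i), ← add_sum_erase univ (fun l => g (f l)) (mem_univ i),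
      sum_congr rfl (g := fun l => g (f l))]
    · rw [Function.update_self]
      ring
    · intro l hl
      rw [Function.update_of_ne (ne_of_mem_erase hl)]
  have h1 := key (Function.update f i a) j b
  have h2 := key f i a
  rw [Function.update_of_ne hij.symm] at h1
  omega

variable {F : Finset (Finset α)}

/-- `S \ A` has at least two elements, and for a fixed `a` at most one of them can give an exchange
landing in `F`. -/
lemma IsStableFamily.exists_simultaneous_exchange (hF : IsStableFamily k F) {A S : Finset α}
    (hA : A ∈ F) (hS : #S = k) (hSA : #(S ∩ A) + 2 ≤ k) :
    ∃ a ∈ A, ∃ b ∈ S, a ∉ S ∧ b ∉ A ∧ insert a (S.erase b) ∉ F := by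
  have h1 := card_sdiff_add_card_inter A S
  have h2 := card_sdiff_add_card_inter S A
  rw [hF.card_eq hA, inter_comm] at h1
  obtain ⟨a, ha⟩ := card_pos.1 (show 0 < #(A \ S) by omega)
  obtain ⟨b, hb, b', hb', hne⟩ := one_lt_card.1 (show 1 < #(S \ A) by omega)
  rw [mem_sdiff] at ha hb hb'
  by_cases h : insert a (S.erase b) ∈ F
  · exact ⟨a, ha.1, b', hb'.1, ha.2, hb'.2, hF.exchange_left hb.1 hb'.1 ha.2 hne h⟩
  · exact ⟨a, ha.1, b, hb.1, ha.2, hb.2, h⟩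

/-- Start from a decomposition into arbitrary `k`-sets and remove members of `F` one at a time. A
swap of two elements between a forbidden set and another summand preserves `z` and leaves both new
sets outside `F`. -/
lemma IsStableFamily.exists_decomposition [Fintype α] (hF : IsStableFamily k F) (hk : 0 < k) {t : ℕ}
    {z : α → ℕ} (hz : ∀ x, z x ≤ t) (hsum : ∑ x, z x = k * t)
    (hH : ∀ H ∈ F, ∑ x ∈ H, z x ≤ (k - 1) * t) :
    ∃ f : Fin t → Finset α, (∀ i, #(f i) = k ∧ f i ∉ F) ∧
      ∀ x, z x = ∑ i, if x ∈ f i then 1 else 0 := by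
  suffices ∀ m, ∀ f : Fin t → Finset α, (∑ i, if f i ∈ F then 1 else 0) ≤ m → (∀ i, #(f i) = k) →
      (∀ x, z x = ∑ i, if x ∈ f i then 1 else 0) →
      ∃ f : Fin t → Finset α, (∀ i, #(f i) = k ∧ f i ∉ F) ∧
      ∀ x, z x = ∑ i, if x ∈ f i then 1 else 0 by
    obtain ⟨f, hf, hfz⟩ := exists_card_eq_decomposition hz hsum
    exact this _ f le_rfl hf hfz
  intro m
  induction m with
  | zero =>
    intro f hm hf hfz
    refine ⟨f, fun i => ⟨hf i, fun hi => ?_⟩, hfz⟩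
    have := (sum_eq_zero_iff.1 (Nat.le_zero.1 hm)) i (mem_univ i)
    simp [hi] at this
  | succ m ih =>
    intro f hm hf hfz
    by_cases hex : ∃ i, f i ∈ F
    swap
    · push Not at hex
      exact ⟨f, fun i => ⟨hf i, hex i⟩, hfz⟩
    obtain ⟨i, hi⟩ := hex
    have hcount : ∑ x ∈ f i, z x = ∑ j, #(f j ∩ f i) := by
      simp_rw [hfz]
      rw [sum_comm]
      refine sum_congr rfl fun j _ => ?_
      rw [sum_boole, filter_mem_eq_inter, inter_comm, Nat.cast_id]
    -- If every summand met `f i` in at least `k - 1` elements, then, as `f i` meets itself in `k`,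
    -- the sum of `z` over `f i` would exceed `(k - 1) * t`.
    obtain ⟨j, hj⟩ : ∃ j, #(f j ∩ f i) + 2 ≤ k := by
      by_contra! hcon
      have h1 := hH _ hi
      have hlt : ∑ _j : Fin t, (k - 1) < ∑ j, #(f j ∩ f i) := by
        refine sum_lt_sum (fun j _ => ?_) ⟨i, mem_univ i, ?_⟩
        · have := hcon j
          omega
        · rw [inter_self, hf i]
          omega
      rw [← hcount, sum_const, card_univ, Fintype.card_fin, smul_eq_mul, mul_comm] at hlt
      omega
    have hij : i ≠ j := by
      rintro rfl
      rw [inter_self, hf i] at hj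
      omega
    obtain ⟨a, ha, b, hb, haS, hbA, hnot⟩ := hF.exists_simultaneous_exchange hi (hf j) hj
    have hnot' := hF.exchange_notMem hi ha hbA
    refine ih (Function.update (Function.update f i (insert b ((f i).erase a))) j
      (insert a ((f j).erase b))) ?_ ?_ ?_
    · have := sum_update_update f (fun A => if A ∈ F then 1 else 0) hij
        (insert b ((f i).erase a)) (insert a ((f j).erase b))
      simp only [if_pos hi, if_neg hnot, if_neg hnot'] at this
      omega
    · intro l
      by_cases hlj : l = j
      · subst hlj
        rw [Function.update_self, card_insert_erase hb haS, hf]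
      · rw [Function.update_of_ne hlj]
        by_cases hli : l = i
        · subst hli
          rw [Function.update_self, card_insert_erase ha hbA, hf]
        · rw [Function.update_of_ne hli, hf]
    · intro x
      have := sum_update_update f (fun A => if x ∈ A then 1 else 0) hij
        (insert b ((f i).erase a)) (insert a ((f j).erase b))
      rw [hfz x]
      have h2 : ((if x ∈ f i then 1 else 0) + (if x ∈ f j then 1 else 0) : ℕ) =
          (if x ∈ insert b ((f i).erase a) then 1 else 0) +
            (if x ∈ insert a ((f j).erase b) then 1 else 0) := by
        simp only [mem_insert, mem_erase]
        have hab : a ≠ b := fun h => hbA (h ▸ ha)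
        by_cases hxa : x = a
        · subst hxa
          simp [ha, haS, hab]
        · by_cases hxb : x = b
          · subst hxb
            simp [hb, hbA, hab.symm]
          · simp [hxa, hxb]
      omega

end Decomposition

/-! ### Lattice points of the dilated basis polytope -/

section LatticePoints

open Finset

variable {n k : ℕ} {F : Finset (Finset (Fin n))}

lemma IsStableFamily.basisPolytope_le (hF : IsStableFamily k F) (hk : 0 < k)
    (hkn : k < Fintype.card (Fin n))
    {v : Fin n → ℝ} (hv : v ∈ (hF.matroid hk hkn).basisPolytope) :
    (∀ x, 0 ≤ v x ∧ v x ≤ 1) ∧ ∑ x, v x = k ∧ ∀ H ∈ F, ∑ x ∈ H, v x ≤ (k : ℝ) - 1 := by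
  have hconv : Convex ℝ {v : Fin n → ℝ | (∀ x, 0 ≤ v x ∧ v x ≤ 1) ∧ ∑ x, v x = k ∧
      ∀ H ∈ F, ∑ x ∈ H, v x ≤ (k : ℝ) - 1} := by
    rintro v ⟨hv1, hv2, hv3⟩ w ⟨hw1, hw2, hw3⟩ a b ha hb hab
    have hsum : ∀ H : Finset (Fin n), ∑ x ∈ H, (a • v + b • w) x =
        a * ∑ x ∈ H, v x + b * ∑ x ∈ H, w x := fun H => by
      simp [sum_add_distrib, mul_sum]
    refine ⟨fun x => ?_, ?_, fun H hH => ?_⟩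
    · have h1 := hv1 x
      have h2 := hw1 x
      simp only [Pi.add_apply, Pi.smul_apply, smul_eq_mul]
      constructor
      · exact add_nonneg (mul_nonneg ha h1.1) (mul_nonneg hb h2.1)
      · nlinarith [mul_le_mul_of_nonneg_left h1.2 ha, mul_le_mul_of_nonneg_left h2.2 hb]
    · rw [hsum, hv2, hw2, ← add_mul, hab, one_mul]
    · rw [hsum]
      calc _ ≤ a * ((k : ℝ) - 1) + b * ((k : ℝ) - 1) :=
            add_le_add (mul_le_mul_of_nonneg_left (hv3 H hH) ha)
              (mul_le_mul_of_nonneg_left (hw3 H hH) hb)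
        _ = _ := by rw [← add_mul, hab, one_mul]
  refine convexHull_min ?_ hconv hv
  rintro _ ⟨B, hB, rfl⟩
  obtain ⟨S, rfl, hS, hSF⟩ := (hF.matroid_isBase hk hkn).1 hB
  have hsum : ∀ H : Finset (Fin n),
      ∑ x ∈ H, Set.indicator (S : Set (Fin n)) (1 : Fin n → ℝ) x = #(H ∩ S) := fun H => by
    simp [Set.indicator_apply]
  refine ⟨fun x => ?_, by rw [hsum, univ_inter, hS], fun H hH => ?_⟩
  · by_cases hx : x ∈ S <;> simp [hx]
  · rw [hsum]
    have h1 : #(H ∩ S) < k := by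
      refine lt_of_le_of_ne ((card_le_card inter_subset_right).trans hS.le) fun h => ?_
      have h2 : H ∩ S = H := eq_of_subset_of_card_le inter_subset_left (by rw [h, hF.card_eq hH])
      have h3 : H ∩ S = S := eq_of_subset_of_card_le inter_subset_right (by rw [h, hS])
      exact hSF (h3.symm.trans h2 ▸ hH)
    have : (#(H ∩ S) : ℝ) + 1 ≤ k := by exact_mod_cast h1
    linarith

/-- The points of `ℕⁿ` in the `t`-th dilation of the hypersimplex. -/
def hypersimplexPoints (n k t : ℕ) : Finset (Fin n → ℕ) :=
  {z ∈ Fintype.piFinset fun _ => range (t + 1) | ∑ x, z x = k * t}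

lemma mem_hypersimplexPoints {t : ℕ} {z : Fin n → ℕ} :
    z ∈ hypersimplexPoints n k t ↔ (∀ x, z x ≤ t) ∧ ∑ x, z x = k * t := by
  simp [hypersimplexPoints]

lemma IsStableFamily.mem_smul_basisPolytope (hF : IsStableFamily k F) (hk : 0 < k)
    (hkn : k < Fintype.card (Fin n)) {t : ℕ} {z : Fin n → ℕ} :
    (fun x => (z x : ℝ)) ∈ (t : ℝ) • (hF.matroid hk hkn).basisPolytope ↔
      z ∈ hypersimplexPoints n k t ∧ ∀ H ∈ F, ∑ x ∈ H, z x ≤ (k - 1) * t := by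
  rw [mem_hypersimplexPoints]
  constructor
  · rintro ⟨v, hv, hvz⟩
    obtain ⟨h1, h2, h3⟩ := hF.basisPolytope_le hk hkn hv
    have hz : ∀ x, (z x : ℝ) = t * v x := fun x => (congrFun hvz x).symm
    have ht : (0 : ℝ) ≤ t := t.cast_nonneg
    refine ⟨⟨fun x => ?_, ?_⟩, fun H hH => ?_⟩
    · have : (z x : ℝ) ≤ t := by
        rw [hz]
        exact mul_le_of_le_one_right ht (h1 x).2
      exact_mod_cast this
    · have : ((∑ x, z x : ℕ) : ℝ) = ((k * t : ℕ) : ℝ) := by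
        push_cast
        simp_rw [hz]
        rw [← mul_sum, h2, mul_comm]
      exact_mod_cast this
    · have : ((∑ x ∈ H, z x : ℕ) : ℝ) ≤ (((k - 1) * t : ℕ) : ℝ) := by
        push_cast [Nat.cast_sub (Nat.one_le_iff_ne_zero.2 hk.ne')]
        simp_rw [hz]
        rw [← mul_sum, mul_comm]
        exact mul_le_mul_of_nonneg_right (h3 H hH) ht
      exact_mod_cast this
  · rintro ⟨⟨h1, h2⟩, h3⟩
    -- For positive `t` the point is `t` times the average of the bases in a decomposition; for `t =
    -- 0` there is no average, but any basis works.
    rcases Nat.eq_zero_or_pos t with rfl | ht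
    · obtain ⟨B, hB⟩ := (hF.matroid hk hkn).exists_isBase
      refine ⟨_, subset_convexHull ℝ _ ⟨B, hB, rfl⟩, ?_⟩
      ext x
      simp [Nat.le_zero.1 (h1 x)]
    · obtain ⟨f, hf, hfz⟩ := hF.exists_decomposition hk h1 h2 h3
      have ht' : (t : ℝ) ≠ 0 := by exact_mod_cast ht.ne'
      refine ⟨∑ i, (t : ℝ)⁻¹ • Set.indicator (f i : Set (Fin n)) 1, ?_, ?_⟩
      · refine (convex_convexHull ℝ _).sum_mem (fun _ _ => by positivity) (by simp [ht']) ?_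
        exact fun i _ => subset_convexHull ℝ _ ⟨_, (hF.matroid_isBase_coe hk hkn).2 (hf i), rfl⟩
      · ext x
        have : ∑ i, Set.indicator (f i : Set (Fin n)) (1 : Fin n → ℝ) x = z x := by
          simp [hfz x, Set.indicator_apply]
        simp only [← smul_sum, smul_inv_smul₀ ht', Finset.sum_apply, this]

lemma IsStableFamily.latticePointCount_eq (hF : IsStableFamily k F) (hk : 0 < k)
    (hkn : k < Fintype.card (Fin n)) (t : ℕ) :
    latticePointCount (hF.matroid hk hkn).basisPolytope t =
      #{z ∈ hypersimplexPoints n k t | ∀ H ∈ F, ∑ x ∈ H, z x ≤ (k - 1) * t} := by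
  have hinj : Function.Injective fun (w : Fin n → ℕ) i => (w i : ℤ) := fun v w h => by
    ext i
    exact Nat.cast_injective (congrFun h i)
  rw [latticePointCount, ← Set.ncard_coe_finset, ← Set.ncard_image_of_injective _ hinj]
  congr 1
  ext z
  simp only [Set.mem_ofPred_eq, coe_filter, Set.mem_image]
  constructor
  · intro hz
    have hpos : ∀ x, 0 ≤ z x := by
      obtain ⟨v, hv, hvz⟩ := hz
      intro x
      have h : (z x : ℝ) = t * v x := (congrFun hvz x).symm
      have : (0 : ℝ) ≤ z x := by
        rw [h]
        exact mul_nonneg t.cast_nonneg ((hF.basisPolytope_le hk hkn hv).1 x).1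
      exact_mod_cast this
    lift z to Fin n → ℕ using hpos
    exact ⟨z, (hF.mem_smul_basisPolytope hk hkn).1 (by simpa using hz), rfl⟩
  · rintro ⟨w, hw, rfl⟩
    simpa using (hF.mem_smul_basisPolytope hk hkn).2 hw

end LatticePoints

/-! ### Counting points of the hypersimplex and of the cut corners -/

section Counting

open Finset

lemma card_piAntidiag_eq_choose {α : Type*} [DecidableEq α] [Fintype α] (s : Finset α)
    (hs : s.Nonempty) (m : ℕ) : #(piAntidiag s m) = (m + (#s - 1)).choose (#s - 1) := by
  have h1 : #(piAntidiag s m) = #(s.finsuppAntidiag m) := by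
    refine (card_nbij' (fun f : α →₀ ℕ => (f : α → ℕ)) 
      (fun f => Finsupp.equivFunOnFinite.symm f) ?_ ?_ ?_ ?_).symm
    · intro f hf
      simp only [mem_coe, mem_piAntidiag, mem_finsuppAntidiag] at hf ⊢
      exact ⟨hf.1, fun i hi => hf.2 (Finsupp.mem_support_iff.2 hi)⟩
    · intro f hf
      simp only [mem_coe, mem_piAntidiag, mem_finsuppAntidiag] at hf ⊢
      exact ⟨by simpa using hf.1, fun i hi => hf.2 i (by simpa using hi)⟩
    · intro f _
      ext
      simp
    · intro f _
      simp
  have := card_pos.2 hs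
  rw [h1, card_finsuppAntidiag_nat_eq_choose, show #s + m - 1 = m + (#s - 1) by omega,
    Nat.choose_symm_add]

/-- Compare the coefficients of `X ^ (k * t)` in `(1 + X + ⋯ + X ^ t) ^ (N + 1)` and in `(1 - X ^ (t
+ 1)) ^ (N + 1) * (1 - X) ^ (-(N + 1))`. Terms with `j ≥ k` have too high an order to contribute. -/
lemma card_hypersimplexPoints {N k : ℕ} (hk : 0 < k) (hkN : k ≤ N) (t : ℕ) :
    (#(hypersimplexPoints (N + 1) k t) : ℤ) =
      ∑ j ∈ range k, (-1) ^ j * (((N + 1).choose j * ((k - j) * t + (N - j)).choose N : ℕ) : ℤ) := by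
  have hgf : (∑ i ∈ range (t + 1), (PowerSeries.X : PowerSeries ℤ) ^ i) ^ (N + 1) =
      (-PowerSeries.X ^ (t + 1) + 1) ^ (N + 1) *
        PowerSeries.mk fun m => ((N + m).choose N : ℤ) := by
    have h := PowerSeries.mk_add_choose_mul_one_sub_pow_eq_one (S := ℤ) (d := N)
    rw [neg_add_eq_sub, ← geom_sum_mul_neg PowerSeries.X (t + 1), mul_pow,
      mul_assoc, mul_comm ((1 - PowerSeries.X) ^ (N + 1)), h, mul_one]
  have hl : PowerSeries.coeff (k * t)
      ((∑ i ∈ range (t + 1), (PowerSeries.X : PowerSeries ℤ) ^ i) ^ (N + 1)) =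
      #(hypersimplexPoints (N + 1) k t) := by
    rw [sum_pow', map_sum, hypersimplexPoints, card_filter, Nat.cast_sum]
    refine sum_congr rfl fun p _ => ?_
    rw [prod_pow_eq_pow_sum, PowerSeries.coeff_X_pow]
    simp [eq_comm]
  have e : ∀ j : ℕ, ((-PowerSeries.X ^ (t + 1)) ^ j * 1 ^ (N + 1 - j) * ((N + 1).choose j : PowerSeries ℤ) *
      PowerSeries.mk fun m => ((N + m).choose N : ℤ)) =
      PowerSeries.C ((-1) ^ j * ((N + 1).choose j : ℤ)) * (PowerSeries.X ^ ((t + 1) * j) *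
      PowerSeries.mk fun m => ((N + m).choose N : ℤ)) := by
    intro j
    rw [neg_pow, one_pow, ← pow_mul]
    simp only [map_mul, map_pow, map_neg, map_one, map_natCast]
    ring
  rw [← hl, hgf, add_pow, sum_mul, map_sum, ← sum_subset (range_mono (by omega : k ≤ N + 1 + 1))]
  · refine sum_congr rfl fun j hj => ?_
    rw [mem_range] at hj
    rw [e j, PowerSeries.coeff_C_mul, PowerSeries.coeff_X_pow_mul']
    obtain ⟨d, rfl⟩ := Nat.exists_eq_add_of_lt hj
    rw [show j + d + 1 - j = d + 1 by omega]
    have e1 : (j + d + 1) * t = j * t + (d + 1) * t := by ring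
    have e2 : (t + 1) * j = j * t + j := by ring
    split_ifs with h
    · rw [PowerSeries.coeff_mk, show N + ((j + d + 1) * t - (t + 1) * j) =
        (d + 1) * t + (N - j) by omega]
      push_cast
      ring
    -- A term of too high an order needs no separate case in the formula, since its binomial has
    -- upper entry below `N`.
    · rw [Nat.choose_eq_zero_of_lt (show (d + 1) * t + (N - j) < N by omega)]
      simp
  · intro j hj hjk
    rw [mem_range] at hj hjk
    rw [e j, PowerSeries.coeff_C_mul, PowerSeries.coeff_X_pow_mul', if_neg, mul_zero]
    have : k * t ≤ j * t := Nat.mul_le_mul_right t (by omega)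
    have e2 : (t + 1) * j = j * t + j := by ring
    omega

variable {n k : ℕ}

/-- Let `s` be the sum of `z` over `Hᶜ`; the cut condition says `s < t`. Then `t - z` on `H` and `z`
on `Hᶜ` are independent compositions of `s`, and the bound by `t` is automatic. -/
lemma card_hypersimplexPoints_cut {H : Finset (Fin n)} (hH : #H = k) (hk : 0 < k) (hkn : k < n)
    (t : ℕ) : #{z ∈ hypersimplexPoints n k t | (k - 1) * t < ∑ x ∈ H, z x} =
      ∑ s ∈ range t, (s + (k - 1)).choose (k - 1) * (s + (n - k - 1)).choose (n - k - 1) := by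
  have hsplit : ∀ z : Fin n → ℕ, ∑ x ∈ H, z x + ∑ x ∈ Hᶜ, z x = ∑ x, z x :=
    fun z => sum_add_sum_compl H z
  obtain ⟨l, rfl⟩ := Nat.exists_eq_add_of_lt hk
  simp only [zero_add, add_tsub_cancel_right] at *
  have hlt : (l + 1) * t = l * t + t := by ring
  rw [card_eq_sum_card_fiberwise (f := fun z => ∑ x ∈ Hᶜ, z x) (t := range t)]
  swap
  · intro z hz
    simp only [coe_filter, Set.mem_ofPred_eq, mem_hypersimplexPoints] at hz
    have := hsplit z
    simp only [coe_range, Set.mem_Iio]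
    omega
  refine sum_congr rfl fun s hs => ?_
  rw [mem_range] at hs
  have hcompl : #Hᶜ = n - (l + 1) := by rw [card_compl, hH, Fintype.card_fin]
  have hHne : H.Nonempty := card_pos.1 (by omega)
  have hHcne : Hᶜ.Nonempty := card_pos.1 (by omega)
  have c1 := card_piAntidiag_eq_choose H hHne s
  have c2 := card_piAntidiag_eq_choose Hᶜ hHcne s
  rw [hH, add_tsub_cancel_right] at c1
  rw [hcompl] at c2
  rw [← c1, ← c2, ← card_product]
  refine card_nbij'
    (fun z => (fun x => if x ∈ H then t - z x else 0, fun x => if x ∈ H then 0 else z x))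
    (fun p x => if x ∈ H then t - p.1 x else p.2 x) ?_ ?_ ?_ ?_
  · intro z hz
    simp only [coe_filter, mem_filter, Set.mem_ofPred_eq, mem_hypersimplexPoints] at hz
    obtain ⟨⟨⟨h1, h2⟩, h3⟩, h4⟩ := hz
    simp only [coe_product, Set.mem_prod, mem_coe, mem_piAntidiag]
    refine ⟨⟨?_, fun x hx => ?_⟩, ?_, fun x hx => ?_⟩
    · have e1 : ∑ x ∈ H, (t - z x) + ∑ x ∈ H, z x = (l + 1) * t := by
        rw [← sum_add_distrib, sum_congr rfl fun x _ => Nat.sub_add_cancel (h1 x), sum_const, hH,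
          smul_eq_mul]
      rw [sum_congr rfl (g := fun x => t - z x) fun x hx => if_pos hx]
      have := hsplit z
      omega
    · by_contra h
      simp [h] at hx
    · rw [← h4]
      exact sum_congr rfl fun x hx => if_neg (mem_compl.1 hx)
    · by_contra h
      rw [mem_compl, not_not] at h
      simp [h] at hx
  · rintro ⟨u, w⟩ hp
    simp only [coe_product, Set.mem_prod, mem_coe, mem_piAntidiag] at hp
    obtain ⟨⟨h1, h2⟩, h3, h4⟩ := hp
    have hu : ∀ x ∈ H, u x ≤ s := fun x hx => h1 ▸ single_le_sum (fun _ _ => Nat.zero_le _) hx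
    have hw : ∀ x ∈ Hᶜ, w x ≤ s := fun x hx => h3 ▸ single_le_sum (fun _ _ => Nat.zero_le _) hx
    simp only [coe_filter, mem_filter, Set.mem_ofPred_eq, mem_hypersimplexPoints]
    have e1 : ∑ x ∈ H, (if x ∈ H then t - u x else w x) + s = (l + 1) * t := by
      rw [← h1, sum_congr rfl (g := fun x => t - u x) fun x hx => if_pos hx, ← sum_add_distrib,
        sum_congr rfl fun x hx => Nat.sub_add_cancel ((hu x hx).trans hs.le), sum_const, hH,
        smul_eq_mul]
    have e2 : ∑ x ∈ Hᶜ, (if x ∈ H then t - u x else w x) = s := by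
      rw [← h3]
      exact sum_congr rfl fun x hx => if_neg (mem_compl.1 hx)
    refine ⟨⟨⟨fun x => ?_, ?_⟩, ?_⟩, e2⟩
    · split_ifs with hx
      · omega
      · exact (hw x (mem_compl.2 hx)).trans hs.le
    · rw [← hsplit]
      omega
    · omega
  · intro z hz
    simp only [coe_filter, mem_filter, Set.mem_ofPred_eq, mem_hypersimplexPoints] at hz
    ext x
    have := hz.1.1.1 x
    dsimp only
    split_ifs with hx
    · omega
    · rfl
  · rintro ⟨u, w⟩ hp
    simp only [coe_product, Set.mem_prod, mem_coe, mem_piAntidiag] at hp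
    obtain ⟨⟨h1, h2⟩, h3, h4⟩ := hp
    have hu : ∀ x ∈ H, u x ≤ s := fun x hx => h1 ▸ single_le_sum (fun _ _ => Nat.zero_le _) hx
    ext x
    · dsimp only
      split_ifs with hx
      · have := hu x hx
        omega
      · by_contra h
        exact hx (h2 x (Ne.symm h))
    · dsimp only
      split_ifs with hx
      · by_contra h
        exact mem_compl.1 (h4 x (Ne.symm h)) hx
      · rfl

variable {F : Finset (Finset (Fin n))}

/-- Cut corners for `A ≠ B` are disjoint: a common point would have sums over `A` and `B` totalling
more than `2 * (k - 1) * t`, whereas `A ∪ B` carries at most `k * t` and `A ∩ B` at most `(k - 2) *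
t`. -/
lemma IsStableFamily.latticePointCount_add (hF : IsStableFamily k F) (hk : 0 < k)
    (hkn : k < Fintype.card (Fin n)) (t : ℕ) :
    latticePointCount (hF.matroid hk hkn).basisPolytope t +
      #F * ∑ s ∈ range t, (s + (k - 1)).choose (k - 1) * (s + (n - k - 1)).choose (n - k - 1) =
      #(hypersimplexPoints n k t) := by
  have hkn' : k < n := by simpa using hkn
  rw [hF.latticePointCount_eq hk hkn, ← card_filter_add_card_filter_not
    (s := hypersimplexPoints n k t)
    (fun z => ∀ H ∈ F, ∑ x ∈ H, z x ≤ (k - 1) * t), ← smul_eq_mul (a := #F),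
    ← sum_const]
  congr 1
  rw [← sum_congr rfl fun H hH => card_hypersimplexPoints_cut (hF.card_eq hH) hk hkn' t,
    ← card_biUnion]
  · congr 1
    ext z
    simp only [mem_biUnion, mem_filter, not_forall, not_le, exists_prop]
    tauto
  · intro A hA B hB hAB
    refine disjoint_left.2 fun z hzA hzB => ?_
    rw [mem_filter, mem_hypersimplexPoints] at hzA hzB
    have h1 := sum_union_inter (s₁ := A) (s₂ := B) (f := z)
    have h2 : ∑ x ∈ A ∪ B, z x ≤ k * t := hzA.1.2 ▸ sum_le_sum_of_subset (subset_univ _)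
    have h3 : ∑ x ∈ A ∩ B, z x ≤ #(A ∩ B) * t := sum_le_card_nsmul _ _ _ fun x _ => hzA.1.1 x
    have h4 := hF.card_inter hA hB hAB
    obtain ⟨l, rfl⟩ : ∃ l, k = l + 2 := ⟨k - 2, by omega⟩
    have h5 : #(A ∩ B) * t ≤ l * t := Nat.mul_le_mul_right t (by omega)
    have h6 := hzA.2
    have h7 := hzB.2
    rw [show l + 2 - 1 = l + 1 by omega] at h6 h7
    nlinarith

end Counting

/-! ### The counting polynomials and their quadratic coefficients -/

section Polynomials

open Finset Nat

/-- The polynomial `(c X + 1) (c X + 2) ⋯ (c X + m)`. -/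
noncomputable def risingPoly (m : ℕ) (c : ℚ) : ℚ[X] :=
  ∏ l ∈ range m, (C c * X + C ((l : ℚ) + 1))

/-- The second elementary symmetric function of `1, 1/2, …, 1/m`. -/
def harmonicPairs (m : ℕ) : ℚ := ∑ i ∈ range m, harmonic i / (i + 1)

lemma risingPoly_succ (m : ℕ) (c : ℚ) :
    risingPoly (m + 1) c = risingPoly m c * (C c * X + C ((m : ℚ) + 1)) :=
  prod_range_succ _ _

lemma eval_risingPoly (m : ℕ) (c x : ℚ) :
    (risingPoly m c).eval x = ∏ l ∈ range m, (c * x + (l + 1)) := by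
  simp [risingPoly, eval_prod]

lemma coeff_zero_risingPoly (m : ℕ) (c : ℚ) : (risingPoly m c).coeff 0 = m ! := by
  induction m with
  | zero => simp [risingPoly]
  | succ m ih =>
    rw [risingPoly_succ, mul_coeff_zero, ih, factorial_succ, coeff_add, coeff_C_zero,
      coeff_C_mul, coeff_X_zero]
    push_cast
    ring

lemma coeff_succ_mul_linear (p : ℚ[X]) (c a : ℚ) (i : ℕ) :
    (p * (C c * X + C a)).coeff (i + 1) = c * p.coeff i + a * p.coeff (i + 1) := by
  rw [show p * (C c * X + C a) = C c * (p * X) + C a * p by ring, coeff_add, coeff_C_mul,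
    coeff_C_mul, coeff_mul_X]

lemma coeff_one_risingPoly (m : ℕ) (c : ℚ) :
    (risingPoly m c).coeff 1 = c * m ! * harmonic m := by
  induction m with
  | zero => simp [risingPoly, coeff_one]
  | succ m ih =>
    rw [risingPoly_succ, coeff_succ_mul_linear, ih, coeff_zero_risingPoly, factorial_succ,
      harmonic_succ]
    push_cast
    field_simp
    ring

lemma coeff_two_risingPoly (m : ℕ) (c : ℚ) :
    (risingPoly m c).coeff 2 = c ^ 2 * m ! * harmonicPairs m := by
  induction m with
  | zero => simp [risingPoly, harmonicPairs, coeff_one]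
  | succ m ih =>
    rw [risingPoly_succ, coeff_succ_mul_linear, ih, coeff_one_risingPoly, factorial_succ,
      harmonicPairs, harmonicPairs, sum_range_succ]
    push_cast
    field_simp
    ring

lemma cast_choose_mul_factorial (x N : ℕ) :
    (x.choose N : ℚ) * N ! = ∏ l ∈ range N, ((x : ℚ) - N + (l + 1)) := by
  have h1 : ((x.descFactorial N : ℕ) : ℚ) = ∏ l ∈ range N, ((x : ℚ) - l) := by
    rw [← descPochhammer_eval_eq_descFactorial, descPochhammer_eval_eq_prod_range]
  rw [← Nat.cast_mul, mul_comm, ← descFactorial_eq_factorial_mul_choose, h1,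
    ← prod_range_reflect]
  refine prod_congr rfl fun l hl => ?_
  rw [mem_range] at hl
  rw [Nat.sub_sub, Nat.cast_sub (by omega)]
  push_cast
  ring

lemma cast_choose_add_mul_factorial (x m : ℕ) :
    ((x + m).choose m : ℚ) * m ! = (risingPoly m 1).eval (x : ℚ) := by
  rw [cast_choose_mul_factorial, eval_risingPoly]
  refine prod_congr rfl fun l _ => ?_
  push_cast
  ring

/-- The binomial is a product of consecutive integers from `c * t - i` to `c * t + r`, split at the
middle factor `c * t`. -/
lemma choose_shift_mul_factorial (c t i r : ℕ) :
    ((c * t + r).choose (i + 1 + r) : ℚ) * (i + 1 + r)! =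
      (-1) ^ i * (risingPoly i (-c)).eval (t : ℚ) * (c * t) * (risingPoly r c).eval (t : ℚ) := by
  rw [cast_choose_mul_factorial, prod_range_add, prod_range_succ, eval_risingPoly, eval_risingPoly,
    ← card_range i, ← prod_const, card_range, ← prod_mul_distrib, ← prod_range_reflect _ i]
  congr 1
  · congr 1
    · refine prod_congr rfl fun l hl => ?_
      rw [mem_range] at hl
      rw [Nat.sub_sub, Nat.cast_sub (by omega)]
      push_cast
      ring
    · push_cast
      ring
  · refine prod_congr rfl fun l _ => ?_
    push_cast
    ring

/-- The Ehrhart polynomial of the hypersimplex of rank `K + 1` on `N + 1` elements. -/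
noncomputable def hypersimplexPoly (N K : ℕ) : ℚ[X] :=
  C (1 / (N ! : ℚ)) * risingPoly N (K + 1) - ∑ i ∈ range K, C ((N + 1).choose (i + 1) / (N ! : ℚ)) *
    (risingPoly i (-((K - i : ℕ) : ℚ)) * risingPoly (N - (i + 1)) ((K - i : ℕ) : ℚ) *
      (C ((K - i : ℕ) : ℚ) * X + C 0))

lemma eval_hypersimplexPoly {N K : ℕ} (hK : K < N) (t : ℕ) :
    (hypersimplexPoly N K).eval (t : ℚ) = #(hypersimplexPoints (N + 1) (K + 1) t) := by
  have h := congrArg (Int.cast (R := ℚ)) (card_hypersimplexPoints K.succ_pos hK t)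
  have hN : (N ! : ℚ) ≠ 0 := by exact_mod_cast N.factorial_ne_zero
  rw [Int.cast_natCast] at h
  rw [Nat.succ_eq_add_one] at h
  rw [h, sum_range_succ', hypersimplexPoly, eval_sub, eval_finsetSum, Int.cast_add,
    add_comm (Int.cast (∑ i ∈ range K, _)), sub_eq_add_neg, ← sum_neg_distrib, Int.cast_sum]
  congr 1
  · have := cast_choose_add_mul_factorial ((K + 1) * t) N
    rw [eval_risingPoly] at this
    simp only [eval_mul, eval_C, eval_risingPoly, Nat.sub_zero, pow_zero, choose_zero_right, one_mul,
      Int.cast_natCast]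
    rw [one_div, inv_mul_eq_iff_eq_mul₀ hN, mul_comm (N ! : ℚ), this]
    push_cast
    simp
  · refine sum_congr rfl fun i hi => ?_
    rw [mem_range] at hi
    obtain ⟨r, rfl⟩ := Nat.exists_eq_add_of_le (show i + 1 ≤ N by omega)
    have := choose_shift_mul_factorial (K - i) t i r
    rw [show K + 1 - (i + 1) = K - i by omega, show i + 1 + r - (i + 1) = r by omega]
    simp only [eval_mul, eval_C, eval_add, eval_X, add_zero]
    rw [← eq_div_iff hN] at this
    push_cast at this ⊢
    rw [this]
    have hs : (-1 : ℚ) ^ (i + 1) * (-1) ^ i = -1 := by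
      rw [← pow_add, show i + 1 + i = 2 * i + 1 by ring, pow_succ, pow_mul]
      simp
    linear_combination (-((i + 1 + r + 1).choose (i + 1) : ℚ) *
      (eval (t : ℚ) (risingPoly i (-((K - i : ℕ) : ℚ))) * (((K - i : ℕ) : ℚ) * t) *
        eval (t : ℚ) (risingPoly r ((K - i : ℕ) : ℚ))) / ((i + 1 + r)! : ℚ)) * hs

/-- Each summand has a factor `X`, so only the linear coefficient of two rising products matters;
their opposite slopes give the difference of harmonic numbers. Writing the factor with `C 0` lets
`coeff_succ_mul_linear` apply. -/
lemma coeff_two_hypersimplexPoly {N K : ℕ} (hK : K < N) :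
    (hypersimplexPoly N K).coeff 2 = (K + 1) ^ 2 * harmonicPairs N -
      ∑ i ∈ range K, ((K - i : ℕ) : ℚ) ^ 2 * ((N + 1) / ((i + 1) * (N - i : ℕ))) *
        (harmonic (N - (i + 1)) - harmonic i) := by
  have hN : (N ! : ℚ) ≠ 0 := by exact_mod_cast N.factorial_ne_zero
  rw [hypersimplexPoly, coeff_sub, finsetSum_coeff, coeff_C_mul, coeff_two_risingPoly]
  congr 1
  · field_simp
  · refine sum_congr rfl fun i hi => ?_
    rw [mem_range] at hi
    obtain ⟨r, rfl⟩ := Nat.exists_eq_add_of_le (show i + 1 ≤ N by omega)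
    rw [coeff_C_mul, coeff_succ_mul_linear, show i + 1 + r - (i + 1) = r by omega,
      show i + 1 + r - i = r + 1 by omega, coeff_mul]
    simp only [antidiagonal_succ, antidiagonal_zero, map_singleton, sum_cons, sum_singleton,
      Function.Embedding.prodMap, Function.Embedding.coeFn_mk, Prod.map, zero_mul, add_zero]
    have hc : ((i + 1 + r + 1).choose (i + 1) : ℚ) * ((i + 1)! * (r + 1)!) =
        (i + 1 + r + 1) * (i + 1 + r)! := by
      have h1 := Nat.choose_mul_factorial_mul_factorial (show i + 1 ≤ i + 1 + r + 1 by omega)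
      rw [show i + 1 + r + 1 - (i + 1) = r + 1 by omega, factorial_succ (i + 1 + r)] at h1
      rw [← mul_assoc]
      exact_mod_cast h1
    simp only [Function.Embedding.refl_apply, Nat.succ_eq_add_one, zero_add, coeff_zero_risingPoly,
      coeff_one_risingPoly]
    rw [factorial_succ, factorial_succ] at hc
    push_cast at hc ⊢
    have h2 : ((i + 1 + r + 1).choose (i + 1) : ℚ) =
        (i + 1 + r + 1) * (i + 1 + r)! / ((i + 1) * i ! * ((r + 1) * r !)) := by
      rw [eq_div_iff (by positivity)]
      exact hc
    rw [h2]
    field_simp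
    ring

/-- The polynomial in `t` with value `∑ s < t, (s + a).choose a * (s + b).choose b`. -/
noncomputable def chooseSumPoly (b : ℕ) : ℕ → ℚ[X]
  | 0 => C (1 / ((b + 1)! : ℚ)) * (risingPoly b 1 * X)
  | a + 1 => C (1 / ((a : ℚ) + b + 2)) * (C ((a : ℚ) + 1) * chooseSumPoly b a +
      C (1 / (b ! * (a + 1)! : ℚ)) * (risingPoly b 1 * risingPoly a 1 * X * X))

lemma risingPoly_eval_succ (m : ℕ) (x : ℚ) :
    (x + 1) * (risingPoly m 1).eval (x + 1) = (risingPoly m 1).eval x * (x + m + 1) := by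
  simp only [eval_risingPoly]
  have h1 := prod_range_succ (fun l : ℕ => x + ((l : ℚ) + 1)) m
  have h2 := prod_range_succ' (fun l : ℕ => x + ((l : ℚ) + 1)) m
  rw [h1] at h2
  have e : ∏ l ∈ range m, (1 * (x + 1) + ((l : ℚ) + 1)) =
      ∏ l ∈ range m, (x + (((l + 1 : ℕ) : ℚ) + 1)) :=
    prod_congr rfl fun l _ => by push_cast; ring
  rw [e]
  push_cast at h2 ⊢
  simp only [one_mul]
  linear_combination -h2

/-- The recurrence in `a` is a summation by parts: after clearing denominators, both sides vanish at
`t = 0` and have equal increments in `t`. -/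
lemma eval_chooseSumPoly (b a t : ℕ) : (chooseSumPoly b a).eval (t : ℚ) =
    ((∑ s ∈ range t, (s + a).choose a * (s + b).choose b : ℕ) : ℚ) := by
  have hch : ∀ m s : ℕ, ((s + m).choose m : ℚ) = (risingPoly m 1).eval (s : ℚ) / m ! := by
    intro m s
    rw [eq_div_iff (by positivity), cast_choose_add_mul_factorial]
  have hsucc : ∀ a t : ℕ,
      ((∑ s ∈ range (t + 1), (s + a).choose a * (s + b).choose b : ℕ) : ℚ) =
        ((∑ s ∈ range t, (s + a).choose a * (s + b).choose b : ℕ) : ℚ) +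
          (t + a).choose a * (t + b).choose b := fun a t => by
    rw [sum_range_succ, Nat.cast_add, Nat.cast_mul]
  induction a with
  | zero =>
    simp only [chooseSumPoly, eval_mul, eval_C, eval_X]
    induction t with
    | zero => simp
    | succ t ih =>
      rw [hsucc, ← ih]
      have := risingPoly_eval_succ b t
      simp only [add_zero, choose_zero_right, hch, factorial_succ]
      push_cast
      field_simp
      linear_combination this
  | succ a iha =>
    simp only [chooseSumPoly, eval_mul, eval_C, eval_X, eval_add, iha]
    rw [one_div, inv_mul_eq_iff_eq_mul₀ (by positivity)]
    clear iha
    induction t with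
    | zero => simp
    | succ t ih =>
      rw [hsucc, hsucc, mul_add, mul_add, ← ih]
      have h1 := risingPoly_eval_succ b t
      have h2 := risingPoly_eval_succ a t
      have h3 : (risingPoly (a + 1) 1).eval (t : ℚ) = (risingPoly a 1).eval (t : ℚ) * (t + a + 1) := by
        rw [risingPoly_succ]
        simp only [eval_mul, eval_add, eval_C, eval_X]
        ring
      have e : (risingPoly b 1).eval ((t : ℚ) + 1) * (risingPoly a 1).eval ((t : ℚ) + 1) * (t + 1) * (t + 1) =
          (risingPoly b 1).eval (t : ℚ) * (t + b + 1) * ((risingPoly a 1).eval (t : ℚ) * (t + a + 1)) := by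
        rw [← h1, ← h2]
        ring
      push_cast
      simp only [hch, h3, factorial_succ, e]
      push_cast
      field_simp
      ring

/-- The binomial prefactor is the integrating factor of the recurrence in `a`, which then becomes a
plain sum. -/
lemma coeff_two_chooseSumPoly (b a : ℕ) :
    ((a + b + 1).choose a : ℚ) * (chooseSumPoly b a).coeff 2 = harmonic b / (b + 1) +
      ∑ i ∈ range a, ((i + b + 1).choose i : ℚ) / (i + 1) ^ 2 := by
  induction a with
  | zero =>
    rw [chooseSumPoly, coeff_C_mul, coeff_mul_X, coeff_one_risingPoly, factorial_succ]
    push_cast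
    field_simp
    simp
  | succ a ih =>
    rw [sum_range_succ, ← add_assoc, ← ih, chooseSumPoly, coeff_C_mul, coeff_add, coeff_C_mul,
      coeff_C_mul, coeff_mul_X, coeff_mul_X, mul_coeff_zero, coeff_zero_risingPoly,
      coeff_zero_risingPoly, factorial_succ]
    have hc : ((a + 1 + b + 1).choose (a + 1) : ℚ) = (a + b + 2) * (a + b + 1).choose a / (a + 1) := by
      rw [eq_div_iff (by positivity)]
      have := Nat.add_one_mul_choose_eq (a + b + 1) a
      rw [show a + 1 + b + 1 = a + b + 1 + 1 by ring]
      have h := congrArg (Nat.cast (R := ℚ)) this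
      push_cast at h
      linear_combination -h
    rw [hc]
    push_cast
    field_simp

end Polynomials

/-! ### Negativity criterion in rank 9 and numerical estimates -/

section QuadraticCoefficient

open Finset

lemma IsStableFamily.exists_ehrhartPolynomial {b : ℕ} {F : Finset (Finset (Fin (b + 10)))}
    (hF : IsStableFamily 9 F) (hb : 0 < b)
    (hlt : (hypersimplexPoly (b + 9) 8).coeff 2 < #F * (chooseSumPoly b 8).coeff 2) :
    ∃ M : Matroid (Fin (b + 10)), M.E = Set.univ ∧ M.IsConnected ∧ M.IsSparsePaving ∧
      ∃ p : ℚ[X], IsEhrhartPolynomial M.basisPolytope p ∧ ∃ i : ℕ, p.coeff i < 0 := by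
  have hkn : 9 < Fintype.card (Fin (b + 10)) := by
    rw [Fintype.card_fin]
    omega
  refine ⟨hF.matroid (by norm_num) hkn, rfl, hF.matroid_isConnected _ _ (by norm_num)
    (by rw [Fintype.card_fin]; omega) (by rw [Fintype.card_fin]; omega),
    hF.matroid_isSparsePaving _ _,
    hypersimplexPoly (b + 9) 8 - C (#F : ℚ) * chooseSumPoly b 8, fun t => ?_, 2, ?_⟩
  · have := hF.latticePointCount_add (by norm_num) hkn t
    rw [show b + 10 - 9 - 1 = b by omega] at this
    rw [eval_sub, eval_mul, eval_C, eval_hypersimplexPoly (by omega), eval_chooseSumPoly, ← this]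
    push_cast
    ring
  · rw [coeff_sub, coeff_C_mul]
    linarith

/-- The quadratic coefficient of `hypersimplexPoly (b + 9) 8`. -/
def hypersimplexQuadratic (b : ℕ) : ℚ :=
  81 * harmonicPairs (b + 9) - ∑ i ∈ range 8, ((8 - i : ℕ) : ℚ) ^ 2 *
    ((b + 10) / ((i + 1) * (b + 9 - i : ℕ))) * (harmonic (b + 9 - (i + 1)) - harmonic i)

/-- The quadratic coefficient of `chooseSumPoly b 8`, multiplied by `(b + 9).choose 8`. -/
def chooseSumQuadratic (b : ℕ) : ℚ :=
  harmonic b / (b + 1) + ∑ i ∈ range 8, ((i + b + 1).choose i : ℚ) / (i + 1) ^ 2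

lemma coeff_hypersimplexPoly_eq_hypersimplexQuadratic (b : ℕ) :
    (hypersimplexPoly (b + 9) 8).coeff 2 = hypersimplexQuadratic b := by
  rw [coeff_two_hypersimplexPoly (by omega), hypersimplexQuadratic]
  congr 1
  · norm_num
  · refine sum_congr rfl fun i _ => ?_
    push_cast
    ring

lemma harmonic_mono : Monotone harmonic :=
  monotone_nat_of_le_succ fun n => by
    rw [harmonic_succ]
    exact le_add_of_nonneg_right (by positivity)

lemma harmonic_le_of_le {m : ℕ} (hm : 25 ≤ m) : harmonic m ≤ (m + 1) / 4 := by
  induction m, hm using Nat.le_induction with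
  | base => decide +kernel
  | succ m hm ih =>
    rw [harmonic_succ]
    have : (((m + 1 : ℕ) : ℚ))⁻¹ ≤ 4⁻¹ := inv_anti₀ (by norm_num) (by exact_mod_cast (by omega))
    push_cast at this ⊢
    linarith

lemma harmonicPairs_le_of_le {m : ℕ} (hm : 25 ≤ m) : harmonicPairs m ≤ (m + 1) / 4 := by
  induction m, hm using Nat.le_induction with
  | base => decide +kernel
  | succ m hm ih =>
    rw [harmonicPairs, sum_range_succ, ← harmonicPairs]
    have h1 : harmonic m / (m + 1) ≤ 1 / 4 := by
      rw [div_le_iff₀ (by positivity)]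
      linarith [harmonic_le_of_le hm]
    push_cast
    linarith

/-- The constant is `9 * 81 * 64 / 4`, collecting the factors in `hypersimplexQuadratic_lt`. -/
lemma linear_lt_choose_seven {b : ℕ} (hb : 16 ≤ b) : 11664 * (b + 10) < (b + 8).choose 7 := by
  induction b, hb using Nat.le_induction with
  | base => decide +kernel
  | succ b hb ih =>
    rw [show b + 1 + 8 = b + 8 + 1 by ring, Nat.choose_succ_succ' (b + 8) 6, show 6 + 1 = 7 from rfl]
    have h1 : (24).choose 6 ≤ (b + 8).choose 6 := Nat.choose_le_choose 6 (by omega)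
    have h2 : (24).choose 6 = 134596 := by decide +kernel
    omega

/-- The factor `9` reflects a family of at least `(b + 9).choose 8 / 9` sets. For large `b`, crude
bounds suffice: the subtracted sum is dropped, leaving linear growth, against the `i = 7` term
alone, of degree seven. -/
lemma hypersimplexQuadratic_lt {b : ℕ} (hb : 10 ≤ b) :
    9 * hypersimplexQuadratic b < chooseSumQuadratic b := by
  rcases lt_or_ge b 16 with h | h
  · interval_cases b <;> decide +kernel
  · have h1 : hypersimplexQuadratic b ≤ 81 * harmonicPairs (b + 9) := by
      refine sub_le_self _ (sum_nonneg fun i hi => ?_)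
      rw [mem_range] at hi
      have : harmonic i ≤ harmonic (b + 9 - (i + 1)) := harmonic_mono (by omega)
      exact mul_nonneg (by positivity) (by linarith)
    have h2 := harmonicPairs_le_of_le (m := b + 9) (by omega)
    have h3 : ((7 + b + 1).choose 7 : ℚ) / 64 ≤ chooseSumQuadratic b := by
      have h4 : (0 : ℚ) ≤ harmonic b / (b + 1) :=
        div_nonneg (harmonic_mono (Nat.zero_le b)) (by positivity)
      have h5 := single_le_sum (s := range 8) (f := fun i : ℕ => ((i + b + 1).choose i : ℚ) / (i + 1) ^ 2)
        (fun i _ => by positivity) (mem_range.2 (show 7 < 8 by norm_num))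
      rw [chooseSumQuadratic]
      norm_num at h5 ⊢
      linarith
    have h6 := linear_lt_choose_seven h
    rw [show 7 + b + 1 = b + 8 by ring] at h3
    have h7 : (11664 * (b + 10) : ℚ) < (b + 8).choose 7 := by exact_mod_cast h6
    push_cast at h2
    linarith

/-- Here 43758 is `(18).choose 8` and 6327 is the size of the code on 19 points. -/
lemma hypersimplexQuadratic_nine_lt :
    43758 * hypersimplexQuadratic 9 < 6327 * chooseSumQuadratic 9 := by
  decide +kernel

lemma IsStableFamily.exists_of_lt {b : ℕ} {F : Finset (Finset (Fin (b + 10)))}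
    (hF : IsStableFamily 9 F) (hb : 0 < b)
    (hlt : (b + 9).choose 8 * hypersimplexQuadratic b < #F * chooseSumQuadratic b) :
    ∃ M : Matroid (Fin (b + 10)), M.E = Set.univ ∧ M.IsConnected ∧ M.IsSparsePaving ∧
      ∃ p : ℚ[X], IsEhrhartPolynomial M.basisPolytope p ∧ ∃ i : ℕ, p.coeff i < 0 := by
  refine hF.exists_ehrhartPolynomial hb ?_
  have h := coeff_two_chooseSumPoly b 8
  have hpos : (0 : ℚ) < ((b + 9).choose 8 : ℚ) := by
    exact_mod_cast Nat.choose_pos (by omega)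
  rw [← chooseSumQuadratic, show 8 + b + 1 = b + 9 by ring] at h
  rw [coeff_hypersimplexPoly_eq_hypersimplexQuadratic]
  refine lt_of_mul_lt_mul_left ?_ hpos.le
  rw [mul_left_comm, h]
  exact hlt

end QuadraticCoefficient

/-! ### Stable families from sums modulo `n` -/

section SumCode

open Finset

/-- Two `k`-sets sharing `k - 1` elements and having equal sums modulo `n` would agree in the last
element too, so each residue class is stable; some class has at least average size. -/
lemma exists_isStableFamily_of_sum (n k : ℕ) [NeZero n] :
    ∃ F : Finset (Finset (Fin n)), IsStableFamily k F ∧ n.choose k ≤ n * #F := by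
  have hn : (n : ℚ) ≠ 0 := by exact_mod_cast NeZero.ne n
  obtain ⟨r, -, hr⟩ := exists_le_card_fiber_of_nsmul_le_card_of_maps_to
    (s := powersetCard k (univ : Finset (Fin n))) (t := (univ : Finset (Fin n)))
    (f := fun S => ∑ x ∈ S, x) (b := (n.choose k : ℚ) / n) (fun _ _ => mem_univ _) univ_nonempty
    (by rw [card_univ, Fintype.card_fin, card_powersetCard, card_univ, Fintype.card_fin,
      nsmul_eq_mul, mul_div_cancel₀ _ hn])
  refine ⟨{S ∈ powersetCard k (univ : Finset (Fin n)) | ∑ x ∈ S, x = r},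
    ⟨fun A hA => ?_, fun A hA B hB hne => ?_⟩, ?_⟩
  rotate_left 2
  · rw [div_le_iff₀' (by positivity)] at hr
    exact_mod_cast hr
  · exact (mem_powersetCard.1 (mem_filter.1 hA).1).2
  · rw [mem_filter, mem_powersetCard] at hA hB
    obtain ⟨⟨-, hA⟩, hAr⟩ := hA
    obtain ⟨⟨-, hB⟩, hBr⟩ := hB
    by_contra! hlt
    have h1 := card_sdiff_add_card_inter A B
    have h2 := card_sdiff_add_card_inter B A
    rw [inter_comm] at h2
    have hA1 : (A \ B).Nonempty := by
      rw [sdiff_nonempty]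
      exact fun h => hne (eq_of_subset_of_card_le h (by rw [hA, hB]))
    have hpos := card_pos.2 hA1
    obtain ⟨a, ha⟩ := card_eq_one.1 (show #(A \ B) = 1 by omega)
    obtain ⟨c, hc⟩ := card_eq_one.1 (show #(B \ A) = 1 by omega)
    have h3 := sum_inter_add_sum_sdiff A B (fun x => x)
    have h4 := sum_inter_add_sum_sdiff B A (fun x => x)
    rw [inter_comm, hc, sum_singleton, hBr, ← hAr, ← h3, ha, sum_singleton] at h4
    have hac := add_left_cancel h4
    have hmem : a ∈ A \ B := ha ▸ mem_singleton_self a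
    have hmem' : c ∈ B \ A := hc ▸ mem_singleton_self c
    rw [mem_sdiff] at hmem hmem'
    exact hmem'.2 (hac ▸ hmem.1)

lemma exists_ehrhartPolynomial_of_ten_le {b : ℕ} (hb : 10 ≤ b) :
    ∃ M : Matroid (Fin (b + 10)), M.E = Set.univ ∧ M.IsConnected ∧ M.IsSparsePaving ∧
      ∃ p : ℚ[X], IsEhrhartPolynomial M.basisPolytope p ∧ ∃ i : ℕ, p.coeff i < 0 := by
  obtain ⟨F, hF, hcard⟩ := exists_isStableFamily_of_sum (b + 10) 9
  refine hF.exists_of_lt (by omega) ?_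
  have h1 := Nat.add_one_mul_choose_eq (b + 9) 8
  have h2 : (b + 10) * (b + 9).choose 8 ≤ (b + 10) * (9 * #F) := by
    calc _ = (b + 10).choose 9 * 9 := h1
      _ ≤ (b + 10) * #F * 9 := Nat.mul_le_mul_right 9 hcard
      _ = _ := by ring
  have h3 : ((b + 9).choose 8 : ℚ) ≤ 9 * #F := by
    exact_mod_cast Nat.le_of_mul_le_mul_left h2 (by omega)
  have h4 : (0 : ℚ) < (b + 9).choose 8 := by exact_mod_cast Nat.choose_pos (by omega)
  have h5 : (0 : ℚ) < #F := by linarith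
  have h6 := hypersimplexQuadratic_lt hb
  have hW : 0 ≤ chooseSumQuadratic b :=
    add_nonneg (div_nonneg (harmonic_mono (Nat.zero_le b)) (by positivity))
      (sum_nonneg fun i _ => by positivity)
  calc _ < ((b + 9).choose 8 : ℚ) * (chooseSumQuadratic b / 9) :=
        mul_lt_mul_of_pos_left (by linarith) h4
    _ ≤ 9 * #F * (chooseSumQuadratic b / 9) := mul_le_mul_of_nonneg_right h3 (by positivity)
    _ = _ := by ring

end SumCode

/-! ### An affine-invariant code on 19 points -/

section AffineCode

open Finset

/-- The set of residues modulo `19` at which the binary digit of `m` is `1`. -/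
def blockSet (m : ℕ) : Finset (ZMod 19) := {x | m.testBit x.val}

/-- The number obtained from `m` by clearing its lowest binary digit `1`. -/
def clearLowest (m : ℕ) : ℕ := Nat.land m (Nat.sub m 1)

/-- For `m = 2 ^ k * (2 * r + 1)`, subtracting one leaves all digits above position `k` unchanged,
so only digit `k` is lost. -/
lemma exists_forall_testBit_clearLowest (m : ℕ) :
    ∃ p, ∀ x, x ≠ p → m.testBit x = true → (clearLowest m).testBit x = true := by
  rcases Nat.eq_zero_or_pos m with rfl | hm
  · exact ⟨0, fun x _ h => by simp at h⟩
  · obtain ⟨k, q, ⟨r, rfl⟩, rfl⟩ := Nat.exists_eq_two_pow_mul_odd hm.ne'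
    have hpos : 0 < 2 ^ k := by positivity
    have hlt : 2 ^ k < 2 ^ (k + 1) := Nat.pow_lt_pow_right (by norm_num) (by omega)
    have e1 : 2 ^ k * (2 * r + 1) = 2 ^ (k + 1) * r + 2 ^ k := by ring
    have e2 : 2 ^ k * (2 * r + 1) - 1 = 2 ^ (k + 1) * r + (2 ^ k - 1) := by omega
    refine ⟨k, fun x hx h => ?_⟩
    change (2 ^ k * (2 * r + 1) &&& (2 ^ k * (2 * r + 1) - 1)).testBit x = true
    rw [Nat.testBit_and, h, Bool.true_and, e2, Nat.testBit_two_pow_mul_add _ (by omega)]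
    rw [e1, Nat.testBit_two_pow_mul_add _ hlt] at h
    split_ifs at h ⊢ with hxk
    · exact absurd h (by simp [hx.symm])
    · exact h

lemma card_blockSet_le (m : ℕ) : #(blockSet m) ≤ #(blockSet (clearLowest m)) + 1 := by
  obtain ⟨p, hp⟩ := exists_forall_testBit_clearLowest m
  have hsub : blockSet m ⊆ insert (p : ZMod 19) (blockSet (clearLowest m)) := by
    intro x hx
    rw [blockSet, mem_filter] at hx
    rw [mem_insert, blockSet, mem_filter]
    by_cases hxp : x.val = p
    · left
      rw [← hxp, ZMod.natCast_zmod_val]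
    · exact Or.inr ⟨mem_univ _, hp _ hxp hx.2⟩
  exact (card_le_card hsub).trans (card_insert_le _ _)

/-- Whether `m` has at most seven binary digits `1`. -/
def hasAtMostSevenOnes (m : ℕ) : Bool :=
  Nat.beq (clearLowest (clearLowest (clearLowest (clearLowest (clearLowest (clearLowest
    (clearLowest m))))))) 0

lemma card_blockSet_le_seven {m : ℕ} (h : hasAtMostSevenOnes m = true) : #(blockSet m) ≤ 7 := by
  have h0 := Nat.eq_of_beq_eq_true h
  have h1 := card_blockSet_le m
  have h2 := card_blockSet_le (clearLowest m)
  have h3 := card_blockSet_le (clearLowest (clearLowest m))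
  have h4 := card_blockSet_le (clearLowest (clearLowest (clearLowest m)))
  have h5 := card_blockSet_le (clearLowest (clearLowest (clearLowest (clearLowest m))))
  have h6 := card_blockSet_le (clearLowest (clearLowest (clearLowest (clearLowest
    (clearLowest m)))))
  have h7 := card_blockSet_le (clearLowest (clearLowest (clearLowest (clearLowest
    (clearLowest (clearLowest m))))))
  rw [h0, show blockSet 0 = ∅ by simp [blockSet], card_empty] at h7
  omega

/-- The number whose binary digits `1` mark the image of `blockSet m` under `x ↦ a x + b`. -/
def affineMask (a b m : ℕ) : ℕ :=
  ((List.range 19).filter m.testBit).foldr (fun x r => 2 ^ ((a * x + b) % 19) ||| r) 0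

lemma testBit_affineMask {a b m x : ℕ} (hx : x < 19) (h : m.testBit x = true) :
    (affineMask a b m).testBit ((a * x + b) % 19) = true := by
  have key : ∀ l : List ℕ, x ∈ l →
      (l.foldr (fun x r => 2 ^ ((a * x + b) % 19) ||| r) 0).testBit ((a * x + b) % 19) = true := by
    intro l hl
    induction l with
    | nil => simp at hl
    | cons y l ih =>
      rw [List.foldr_cons, Nat.testBit_or, Bool.or_eq_true]
      rcases List.mem_cons.1 hl with rfl | hl
      · exact Or.inl (Nat.testBit_two_pow_self)
      · exact Or.inr (ih hl)
  exact key _ (List.mem_filter.2 ⟨List.mem_range.2 hx, h⟩)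

/-- Binary codes of `9`-subsets of `ZMod 19` whose images under the maps `x ↦ a x + b`, where `a` is
a nonzero square, are all different and form a stable family. -/
def baseBlocks : List ℕ :=
  [1471, 1911, 2029, 2813, 3051, 3295, 3453, 3647, 4019, 4599, 5023, 5113, 5583, 5755, 5935,
   5981, 6115, 6511, 6751, 7027, 7079, 7117, 7355, 7511, 7665, 7797, 7891, 7993, 8011, 8575,
   9469, 9703, 9903, 12003, 12071, 12765, 13147]

/-- The nonzero squares modulo `19`. -/
def nonzeroSquares : Finset (ZMod 19) := {1, 4, 5, 6, 7, 9, 11, 16, 17}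

/-- Affine symmetry allows one of the two blocks to be left unmoved, and swapping them allows `m ≤
m'`. Sets are coded as binary numbers, so intersections are bitwise. -/
lemma baseBlocks_check :
    (baseBlocks.all fun m => [1, 4, 5, 6, 7, 9, 11, 16, 17].all fun a => (List.range 19).all fun b =>
      baseBlocks.all fun m' => !(Nat.ble m m') ||
        (hasAtMostSevenOnes (Nat.land m' (affineMask a b m)) || (a == 1 && b == 0 && m == m'))) =
    true := by
  decide +kernel

lemma card_blockSet_inter_image {m m' : ℕ} (hm : m ∈ baseBlocks) (hm' : m' ∈ baseBlocks)
    (hle : m ≤ m') {a b : ZMod 19} (ha : a ∈ nonzeroSquares) (hne : ¬(a = 1 ∧ b = 0 ∧ m = m')) :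
    #(blockSet m' ∩ (blockSet m).image fun x => a * x + b) ≤ 7 := by
  have ha' : a.val ∈ [1, 4, 5, 6, 7, 9, 11, 16, 17] := by
    have : ∀ a ∈ nonzeroSquares, a.val ∈ [1, 4, 5, 6, 7, 9, 11, 16, 17] := by decide +kernel
    exact this a ha
  have hb' : b.val ∈ List.range 19 := List.mem_range.2 (ZMod.val_lt b)
  have h := List.all_eq_true.1 (List.all_eq_true.1 (List.all_eq_true.1 (List.all_eq_true.1
    baseBlocks_check m hm) _ ha') _ hb') m' hm'
  rw [Bool.or_eq_true, Bool.or_eq_true] at h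
  rcases h with h | h | h
  · rw [Bool.not_eq_true', ← Bool.not_eq_true, Nat.ble_eq] at h
    exact absurd hle h
  · refine le_trans (card_le_card fun y hy => ?_) (card_blockSet_le_seven h)
    rw [mem_inter, mem_image] at hy
    obtain ⟨hy, x, hx, rfl⟩ := hy
    rw [blockSet, mem_filter] at hx hy ⊢
    refine ⟨mem_univ _, ?_⟩
    change (m' &&& affineMask a.val b.val m).testBit _ = true
    rw [Nat.testBit_and, hy.2, Bool.true_and, ZMod.val_add, ZMod.val_mul, Nat.mod_add_mod]
    exact testBit_affineMask (ZMod.val_lt x) hx.2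
  · simp only [Bool.and_eq_true, beq_iff_eq] at h
    refine absurd ⟨?_, ?_, h.2⟩ hne
    · exact ZMod.val_injective 19 h.1.1
    · exact ZMod.val_injective 19 h.1.2

/-- The image of `blockSet p.2.2` under `x ↦ p.1 x + p.2.1`. -/
def affineBlock (p : ZMod 19 × ZMod 19 × ℕ) : Finset (ZMod 19) :=
  (blockSet p.2.2).image fun x => p.1 * x + p.2.1

/-- The parameters of the blocks of the code. -/
def affineIndices : Finset (ZMod 19 × ZMod 19 × ℕ) :=
  nonzeroSquares ×ˢ univ ×ˢ baseBlocks.toFinset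

instance fact_prime_nineteen : Fact (Nat.Prime 19) := ⟨by norm_num⟩

lemma affine_injective {a : ZMod 19} (ha : a ∈ nonzeroSquares) (b : ZMod 19) :
    Function.Injective fun x => a * x + b := by
  have h0 : a ≠ 0 := by
    rintro rfl
    revert ha
    decide
  exact (add_left_injective b).comp (mul_right_injective₀ h0)

lemma mem_affineIndices {p : ZMod 19 × ZMod 19 × ℕ} :
    p ∈ affineIndices ↔ p.1 ∈ nonzeroSquares ∧ p.2.2 ∈ baseBlocks := by
  simp [affineIndices]

lemma card_affineBlock {p : ZMod 19 × ZMod 19 × ℕ} (hp : p ∈ affineIndices) :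
    #(affineBlock p) = 9 := by
  rw [mem_affineIndices] at hp
  rw [affineBlock, card_image_of_injective _ (affine_injective hp.1 _)]
  have : ∀ m ∈ baseBlocks, #(blockSet m) = 9 := by decide +kernel
  exact this _ hp.2

lemma card_affineBlock_inter {p q : ZMod 19 × ZMod 19 × ℕ} (hp : p ∈ affineIndices)
    (hq : q ∈ affineIndices) (hpq : p ≠ q) : #(affineBlock p ∩ affineBlock q) ≤ 7 := by
  wlog hle : p.2.2 ≤ q.2.2 generalizing p q
  · rw [inter_comm]
    exact this hq hp hpq.symm (le_of_not_ge hle)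
  rw [mem_affineIndices] at hp hq
  obtain ⟨a, b, m⟩ := p
  obtain ⟨a', b', m'⟩ := q
  dsimp only at hp hq hle
  -- Undo the affine map of the second block: the nonzero squares are closed under division, so the
  -- first map factors through it as `x ↦ c * x + d`.
  obtain ⟨c, hc, rfl⟩ : ∃ c ∈ nonzeroSquares, a' * c = a := by
    have : ∀ a ∈ nonzeroSquares, ∀ a' ∈ nonzeroSquares, ∃ c ∈ nonzeroSquares, a' * c = a := by
      decide +kernel
    exact this a hp.1 a' hq.1
  obtain ⟨d, hd⟩ : ∃ d, a' * d + b' = b :=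
    (Finite.injective_iff_surjective.1 (affine_injective hq.1 b')) b
  have e : affineBlock (a' * c, b, m) =
      ((blockSet m).image fun x => c * x + d).image fun x => a' * x + b' := by
    rw [affineBlock, image_image]
    refine image_congr fun x _ => ?_
    simp only [Function.comp_apply, ← hd]
    ring
  rw [e, affineBlock, ← image_inter _ _ (affine_injective hq.1 b'),
    card_image_of_injective _ (affine_injective hq.1 b'), inter_comm]
  refine card_blockSet_inter_image hp.2 hq.2 hle hc ?_
  rintro ⟨rfl, rfl, rfl⟩
  simp [← hd] at hpq

/-- The count is `9 * 19 * 37`: multipliers, translations and base blocks. -/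
lemma card_affineIndices : #affineIndices = 6327 := by
  rw [affineIndices, card_product, card_product, card_univ, ZMod.card]
  decide +kernel

lemma exists_isStableFamily_nineteen :
    ∃ F : Finset (Finset (ZMod 19)), IsStableFamily 9 F ∧ #F = 6327 := by
  refine ⟨affineIndices.image affineBlock, ⟨?_, ?_⟩, ?_⟩
  · intro A hA
    obtain ⟨p, hp, rfl⟩ := mem_image.1 hA
    exact card_affineBlock hp
  · intro A hA B hB hne
    obtain ⟨p, hp, rfl⟩ := mem_image.1 hA
    obtain ⟨q, hq, rfl⟩ := mem_image.1 hB
    have := card_affineBlock_inter hp hq (fun h => hne (h ▸ rfl))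
    omega
  -- Distinct parameters give blocks meeting in at most seven points, so the nine-element blocks are
  -- distinct.
  · rw [card_image_of_injOn, card_affineIndices]
    intro p hp q hq hpq
    by_contra hne
    have h1 := card_affineBlock_inter hp hq hne
    rw [← hpq, inter_self, card_affineBlock hp] at h1
    omega

lemma exists_ehrhartPolynomial_nineteen :
    ∃ M : Matroid (Fin 19), M.E = Set.univ ∧ M.IsConnected ∧ M.IsSparsePaving ∧
      ∃ p : ℚ[X], IsEhrhartPolynomial M.basisPolytope p ∧ ∃ i : ℕ, p.coeff i < 0 := by
  obtain ⟨F, hF, hcard⟩ := exists_isStableFamily_nineteen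
  -- `ZMod 19` is identified with `Fin (9 + 10)` by definitional unfolding.
  refine IsStableFamily.exists_of_lt (b := 9) (F := F) hF (by norm_num) ?_
  have h := hypersimplexQuadratic_nine_lt
  have hc : (9 + 9).choose 8 = 43758 := by decide +kernel
  erw [hcard, hc]
  exact_mod_cast h

end AffineCode

theorem mainTheorem1 (n : ℕ) (hn : 19 ≤ n) :
    ∃ M : Matroid (Fin n), M.E = Set.univ ∧ M.IsConnected ∧ M.IsSparsePaving ∧
      ∃ p : ℚ[X], IsEhrhartPolynomial M.basisPolytope p ∧ ∃ i : ℕ, p.coeff i < 0 := by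
  obtain rfl | h := hn.eq_or_lt
  · exact exists_ehrhartPolynomial_nineteen
  · obtain ⟨b, rfl⟩ := Nat.exists_eq_add_of_le' (show 10 ≤ n by omega)
    exact exists_ehrhartPolynomial_of_ten_le (by omega)
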